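/- Let $B_n$ be the Bernoulli numbers, defined by $\frac{x}{e^x-1}=\sum_{n\ge 0}B_n\frac{x^n}{n!}$, and put $\bar B_n=\frac{1-2^{n-1}}{2^{n-1}}B_n$, $H_N=\sum_{j=1}^{N}\frac1j$ and $H_{N,2}=\sum_{1\le i<j\le N}\frac{1}{ij}$. Then for every integer $n\ge 3$, $$ \begin{aligned} \sum_{\substack{k+l+m=n\\ k,l,m\ge 1}}\frac{\bar B_{2k}\bar B_{2l}\bar B_{2m}}{(2k)(2l)(2m)} ={}&\frac{3}{2n}\sum_{\substack{k+l+m=n\\ k,l,m\ge 1}}\frac{B_{2k}B_{2l}\bar B_{2m}}{(2k)(2l)}\binom{2n}{2k,\,2l,\,2m} +\frac{3}{n}H_{2n}\sum_{k=1}^{n-1}\binom{2n}{2k}\frac{B_{2k}\bar B_{2n-2k}}{2k}\\ &+\frac{3}{2n^2}\sum_{k=1}^{n-1}\binom{2n}{2k}\frac{B_{2k}}{2k}\bigl(B_{2n-2k}-\bar B_{2n-2k}\bigr) +\frac{3}{2n^2}H_{2n-1}\bigl(B_{2n}-\bar B_{2n}\bigr)\\ &+6H_{2n,2}\frac{\bar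 B_{2n}}{2n}-\frac{2n-1}{4}\bar B_{2n-2}, \end{aligned} $$ where $\binom{2n}{2k,\,2l,\,2m}=\frac{(2n)!}{(2k)!\,(2l)!\,(2m)!}$. -/

import Mathlib

open Finset

/-- The modified Bernoulli numbers `B̄_n = ((1 - 2^(n-1)) / 2^(n-1)) * B_n`, with integer exponent
`n - 1`. Here `bernoulli` is the convention `x / (e^x - 1) = ∑ B_n x^n / n!`. -/
def bernoulliBar (n : ℕ) : ℚ :=
  (1 - (2 : ℚ) ^ ((n : ℤ) - 1)) / (2 : ℚ) ^ ((n : ℤ) - 1) * bernoulli n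

/-- `H_{N,2} = ∑_{1 ≤ i < j ≤ N} 1 / (i j)`. -/
def harmonicTwo (N : ℕ) : ℚ :=
  ∑ p ∈ (Icc 1 N ×ˢ Icc 1 N).filter (fun p => p.1 < p.2), 1 / ((p.1 : ℚ) * (p.2 : ℚ))

/-- The triples `(k, l, m)` of integers `≥ 1` with `k + l + m = n`. -/
def positiveTriples (n : ℕ) : Finset (ℕ × ℕ × ℕ) :=
  (Icc 1 n ×ˢ Icc 1 n ×ˢ Icc 1 n).filter (fun t => t.1 + t.2.1 + t.2.2 = n)

/-- The trinomial coefficient `(a + b + c)! / (a! b! c!)`. -/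
def trinomial (a b c : ℕ) : ℕ := Nat.multinomial Finset.univ ![a, b, c]

/-! Let S = sinh(x/2)/(x/2), L = log S and β = 1/S, the exponential generating function of the B̄_n.
The identity compares the t³-coefficients of two expressions for one polynomial in t.

For natural k, the formal Laplace transform of (xS)^k = e^{-kx/2}(e^x-1)^k gives ∑_m (k+1)⋯(k+m)
[x^m]S^k y^m = ∏_{j≤k} (1-(j-k/2)y)⁻¹ (`prod_mul_centralSeries`). The logarithm of the right side is
a series in the power sums of the numbers j-k/2. These are polynomials in t = k+1 with only odd
powers of t (`eval_powerSumPoly`). Hence the right side is exp(tφ + t³χ + O(t⁵)), with φ = ∑ B̄_r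
y^r/r and χ = ∑ (r-1)B̄_{r-2} y^r/24, and its t³-coefficient is φ³/6 + χ.

On the left, S^k = exp(tL)β, so the coefficient of y^{m+1} is t(t+1)⋯(t+m) [x^{m+1}] exp(tL)β. The
rising factorial contributes m!, m!·H_m and m!·H_{m,2} in degrees 1, 2, 3
(`coeff_ascPochhammer_succ`). Both sides are polynomial in t and agree at every positive integer, so
they agree in degree 3 (`coeff_barLogSeries_pow_three`). Taking m+1 = 2n and writing out the
convolutions gives the theorem. -/

namespace BernoulliCubic

open PowerSeries

/-! ### Formal linear differential equations -/

section ODE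

/-- A linear first order differential equation determines a power series from its constant term. -/
theorem eq_of_derivative_eq_mul {R : Type*} [CommRing R] [IsAddTorsionFree R] {A f g : R⟦X⟧}
    (hf : derivative R f = A * f) (hg : derivative R g = A * g)
    (h0 : constantCoeff f = constantCoeff g) : f = g := by
  ext n
  induction n using Nat.strong_induction_on with
  | _ n ih =>
    cases n with
    | zero => simpa using h0
    | succ n =>
      have h4 : (n + 1) • coeff (n + 1) f = (n + 1) • coeff (n + 1) g := by
        have h5 : coeff n (derivative R f) = coeff n (derivative R g) := by
          rw [hf, hg, coeff_mul, coeff_mul]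
          refine sum_congr rfl fun p hp => ?_
          rw [ih p.2 (by have := mem_antidiagonal.1 hp; omega)]
        rw [coeff_derivative, coeff_derivative] at h5
        simpa [nsmul_eq_mul, mul_comm] using h5
      exact nsmul_right_injective (Nat.succ_ne_zero n) h4

theorem map_derivative {R S : Type*} [CommRing R] [CommRing S] (φ : R →+* S) (f : R⟦X⟧) :
    PowerSeries.map φ (derivative R f) = derivative S (PowerSeries.map φ f) := by
  ext n
  simp [coeff_derivative]

/-- Every formal logarithmic derivative is attained. -/
theorem exists_derivative_eq_mul {R : Type*} [CommRing R] [Algebra ℚ R] {B : R⟦X⟧}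
    (hB : constantCoeff B = 0) :
    ∃ E : R⟦X⟧, constantCoeff E = 1 ∧ derivative R E = derivative R B * E := by
  have hs : HasSubst B := HasSubst.of_constantCoeff_zero' hB
  -- The solution is E = exp(B).
  refine ⟨(exp R).subst B, ?_, ?_⟩
  · rw [constantCoeff_eq, constantCoeff_subst hs, finsum_eq_single _ 0]
    · simp
    · intro d hd
      rw [constantCoeff_eq] at hB
      simp [hB, hd]
  · rw [derivative_subst hs, derivative_exp, mul_comm]

end ODE

/-! ### Coefficient extraction in the polynomial variable t -/

section Slice

/-- The series of `j`-th coefficients of a power series with polynomial coefficients. -/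
noncomputable def slice (j : ℕ) (f : (Polynomial ℚ)⟦X⟧) : ℚ⟦X⟧ :=
  PowerSeries.mk fun n => (coeff n f).coeff j

@[simp] theorem coeff_slice (j n : ℕ) (f : (Polynomial ℚ)⟦X⟧) :
    coeff n (slice j f) = (coeff n f).coeff j := coeff_mk _ _

theorem slice_mul (j : ℕ) (f g : (Polynomial ℚ)⟦X⟧) :
    slice j (f * g) = ∑ p ∈ antidiagonal j, slice p.1 f * slice p.2 g := by
  ext n
  simp only [coeff_slice, coeff_mul, Polynomial.finsetSum_coeff, Polynomial.coeff_mul, map_sum]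
  exact sum_comm

theorem slice_derivative (j : ℕ) (f : (Polynomial ℚ)⟦X⟧) :
    slice j (derivative _ f) = derivative _ (slice j f) := by
  ext n
  have : ((n : Polynomial ℚ) + 1) = Polynomial.C ((n : ℚ) + 1) := by simp
  rw [coeff_slice, coeff_derivative, coeff_derivative, coeff_slice, this, Polynomial.coeff_mul_C]

theorem slice_map_C_zero (f : ℚ⟦X⟧) : slice 0 (PowerSeries.map Polynomial.C f) = f := by
  ext n
  simp

theorem slice_map_C_of_ne_zero {j : ℕ} (hj : j ≠ 0) (f : ℚ⟦X⟧) :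
    slice j (PowerSeries.map Polynomial.C f) = 0 := by
  ext n
  simp [Polynomial.coeff_C, hj]

/-- The first slices of a series whose logarithmic derivative is odd up to order three. -/
theorem slices_of_derivative_eq_mul {E D : (Polynomial ℚ)⟦X⟧} {φ χ : ℚ⟦X⟧}
    (h1 : constantCoeff E = 1) (hE : derivative _ E = D * E)
    (hD0 : slice 0 D = 0) (hD1 : slice 1 D = derivative _ φ) (hD2 : slice 2 D = 0)
    (hD3 : slice 3 D = derivative _ χ) (hφ : constantCoeff φ = 0) (hχ : constantCoeff χ = 0) :
    slice 0 E = 1 ∧ slice 1 E = φ ∧ 2 * slice 2 E = φ ^ 2 ∧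
      6 * slice 3 E = φ ^ 3 + 6 * χ := by
  have hc : ∀ j, constantCoeff (slice j E) = (1 : Polynomial ℚ).coeff j := by
    intro j
    rw [← coeff_zero_eq_constantCoeff_apply, coeff_slice, coeff_zero_eq_constantCoeff_apply, h1]
  -- Slicing E' = DE by powers of t gives E₁' = φ'E₀, E₂' = φ'E₁ and E₃' = φ'E₂ + χ'E₀, which are
  -- integrated in turn.
  have hs : ∀ j, derivative _ (slice j E) = ∑ p ∈ antidiagonal j, slice p.1 D * slice p.2 E := by
    intro j
    rw [← slice_derivative, hE, slice_mul]
  have e0 : slice 0 E = 1 := by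
    apply derivative.ext
    · rw [hs]; simp [hD0]
    · rw [hc]; simp
  have e1 : slice 1 E = φ := by
    apply derivative.ext
    · rw [hs]; simp [Nat.antidiagonal_succ, hD0, hD1, e0]
    · rw [hc, hφ]; simp [Polynomial.coeff_one]
  have e2 : 2 * slice 2 E = φ ^ 2 := by
    apply derivative.ext
    · have h2 : derivative ℚ (2 : ℚ⟦X⟧) = 0 := (derivative ℚ).map_natCast 2
      rw [Derivation.leibniz, hs, Derivation.leibniz_pow, h2]
      simp [Nat.antidiagonal_succ, hD0, hD1, hD2, e1]
      exact Or.inl (mul_comm _ _)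
    · rw [map_mul, hc]; simp [hφ, Polynomial.coeff_one]
  have e3 : 6 * slice 3 E = φ ^ 3 + 6 * χ := by
    apply derivative.ext
    · have h2 : derivative ℚ (6 : ℚ⟦X⟧) = 0 := (derivative ℚ).map_natCast 6
      rw [map_add, Derivation.leibniz, hs, Derivation.leibniz_pow, Derivation.leibniz, h2]
      simp [Nat.antidiagonal_succ, hD0, hD1, hD2, hD3, e0]
      linear_combination 3 * derivative ℚ φ * e2
    · rw [map_mul, hc]; simp [hφ, hχ, Polynomial.coeff_one]
  exact ⟨e0, e1, e2, e3⟩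

end Slice

/-! ### Formal Laplace transform of exponentials -/

section Laplace

/-- The formal Laplace transform `∑ aₙ xⁿ ↦ ∑ n! aₙ xⁿ`. -/
noncomputable def laplace (f : ℚ⟦X⟧) : ℚ⟦X⟧ :=
  PowerSeries.mk fun n => (n.factorial : ℚ) * coeff n f

theorem laplace_add (f g : ℚ⟦X⟧) : laplace (f + g) = laplace f + laplace g := by
  ext n
  simp [laplace, mul_add]

theorem laplace_C_mul (a : ℚ) (f : ℚ⟦X⟧) : laplace (C a * f) = C a * laplace f := by
  ext n
  simp [laplace]
  ring

/-- Formal integration by parts; it turns differential equations for f into algebraic equations for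
its transform. -/
theorem laplace_eq (f : ℚ⟦X⟧) :
    laplace f = C (constantCoeff f) + X * laplace (derivative ℚ f) := by
  ext n
  cases n with
  | zero => simp [laplace]
  | succ n =>
    rw [map_add, coeff_succ_X_mul]
    simp [laplace, coeff_derivative, Nat.factorial_succ]
    ring

theorem derivative_rescale_exp (a : ℚ) :
    derivative ℚ (rescale a (exp ℚ)) = C a * rescale a (exp ℚ) := by
  ext n
  have : (n.factorial : ℚ) ≠ 0 := by positivity
  simp [coeff_derivative, coeff_rescale, coeff_exp, Nat.factorial_succ]
  field_simp
  ring

theorem rescale_exp_pow (a : ℚ) (k : ℕ) :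
    rescale a (exp ℚ) ^ k = rescale (k * a) (exp ℚ) := by
  induction k with
  | zero => ext n; cases n <;> simp [coeff_one]
  | succ k ih =>
    rw [pow_succ, ih, exp_mul_exp_eq_exp_add]
    congr 2
    push_cast
    ring

theorem derivative_rescale_exp_mul_pow (a : ℚ) (k : ℕ) :
    derivative ℚ (rescale a (exp ℚ) * (exp ℚ - 1) ^ (k + 1)) =
      C a * (rescale a (exp ℚ) * (exp ℚ - 1) ^ (k + 1)) +
        C ((k : ℚ) + 1) * (rescale (a + 1) (exp ℚ) * (exp ℚ - 1) ^ k) := by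
  have h : rescale (a + 1) (exp ℚ) = rescale a (exp ℚ) * exp ℚ := by
    have := exp_mul_exp_eq_exp_add (A := ℚ) a 1
    rw [← this]
    simp
  rw [Derivation.leibniz, Derivation.leibniz_pow, derivative_rescale_exp, map_sub, derivative_exp,
    h]
  simp
  ring

/-- The Laplace transform of `exp (a x) (exp x - 1) ^ k` is a product of geometric series. -/
theorem prod_mul_laplace (k : ℕ) (a : ℚ) :
    (∏ j ∈ range (k + 1), (1 - C (a + j) * X)) *
      laplace (rescale a (exp ℚ) * (exp ℚ - 1) ^ k) = C (k.factorial : ℚ) * X ^ k := by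
  induction k generalizing a with
  | zero =>
    have h := laplace_eq (rescale a (exp ℚ))
    rw [derivative_rescale_exp, laplace_C_mul] at h
    have h0 : constantCoeff (rescale a (exp ℚ)) = 1 := by
      rw [← coeff_zero_eq_constantCoeff_apply, coeff_rescale]
      simp
    rw [h0] at h
    simp at h ⊢
    linear_combination h
  | succ k ih =>
    -- Writing Λ_k(a) for the transform, this yields (1 - aX) Λ_{k+1}(a) = (k+1) X Λ_k(a+1). The
    -- shift in a is why the induction generalizes over a and why the j = 0 factor is split off.
    have h := laplace_eq (rescale a (exp ℚ) * (exp ℚ - 1) ^ (k + 1))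
    rw [derivative_rescale_exp_mul_pow, laplace_add, laplace_C_mul, laplace_C_mul] at h
    have h0 : constantCoeff (rescale a (exp ℚ) * (exp ℚ - 1) ^ (k + 1)) = 0 := by simp
    rw [h0] at h
    rw [prod_range_succ']
    have h1 := ih (a + 1)
    have h2 : ∏ j ∈ range (k + 1), (1 - C (a + ((j + 1 : ℕ) : ℚ)) * X) =
        ∏ j ∈ range (k + 1), (1 - C (a + 1 + (j : ℚ)) * (X : ℚ⟦X⟧)) := by
      refine prod_congr rfl fun j _ => ?_
      congr 3
      push_cast
      ring
    rw [h2, Nat.factorial_succ]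
    push_cast
    simp only [map_zero, zero_add, map_mul, map_add, map_one, add_zero] at h h1 ⊢
    linear_combination (∏ j ∈ range (k + 1), (1 - (C a + 1 + C (j : ℚ)) * (X : ℚ⟦X⟧))) * h
      + (C (k : ℚ) + 1) * X * h1

end Laplace

/-! ### Power sums as a logarithmic derivative -/

section LogDerivative

/-- If `F` inverts `∏ (1 - aⱼ x)`, then its logarithmic derivative generates the power sums. -/
theorem derivative_eq_of_prod_mul_eq_one (a : ℕ → ℚ) (k : ℕ) {F : ℚ⟦X⟧}
    (hF : (∏ j ∈ range k, (1 - C (a j) * X)) * F = 1) :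
    derivative ℚ F = (PowerSeries.mk fun r => ∑ j ∈ range k, a j ^ (r + 1)) * F := by
  have key : ∀ k, derivative ℚ (∏ j ∈ range k, (1 - C (a j) * X)) =
      -(PowerSeries.mk fun r => ∑ j ∈ range k, a j ^ (r + 1)) *
        ∏ j ∈ range k, (1 - C (a j) * X) := by
    intro k
    induction k with
    | zero => simp; ext; simp
    | succ k ih =>
      have h1 : (PowerSeries.mk fun r => ∑ j ∈ range (k + 1), a j ^ (r + 1)) =
          (PowerSeries.mk fun r => ∑ j ∈ range k, a j ^ (r + 1)) +
            PowerSeries.mk fun r => a k ^ (r + 1) := by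
        ext r
        simp [sum_range_succ]
      have h2 : (PowerSeries.mk fun r => a k ^ (r + 1)) * (1 - C (a k) * X) = C (a k) := by
        ext r
        cases r with
        | zero => simp [mul_sub]
        | succ r =>
          rw [mul_sub, mul_one, map_sub, mul_comm, mul_assoc, mul_comm X, coeff_C_mul,
            coeff_succ_mul_X]
          simp
          ring
      rw [prod_range_succ, Derivation.leibniz, ih, h1]
      have h3 : derivative ℚ (1 - C (a k) * X) = -C (a k) := by
        rw [map_sub, Derivation.leibniz]
        simp
      rw [h3, smul_eq_mul, smul_eq_mul]
      linear_combination (∏ j ∈ range k, (1 - C (a j) * X)) * h2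
  have h := congrArg (derivative ℚ) hF
  rw [Derivation.leibniz, key, derivative_one, smul_eq_mul, smul_eq_mul] at h
  linear_combination F * h + ((PowerSeries.mk fun r => ∑ j ∈ range k, a j ^ (r + 1)) * F
    - derivative ℚ F) * hF

end LogDerivative

/-! ### The series of B̄_n, sinh(x/2)/(x/2) and its logarithm -/

section Series

theorem bernoulliBar_eq (n : ℕ) : bernoulliBar n = (2 * (1 / 2 : ℚ) ^ n - 1) * bernoulli n := by
  rw [bernoulliBar, zpow_sub_one₀ two_ne_zero, zpow_natCast, one_div_pow]
  field_simp

theorem bernoulliBar_zero : bernoulliBar 0 = 1 := by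
  rw [bernoulliBar_eq]
  norm_num

theorem bernoulliBar_eq_zero_of_odd {n : ℕ} (hn : Odd n) : bernoulliBar n = 0 := by
  rw [bernoulliBar_eq]
  rcases eq_or_ne n 1 with rfl | h
  · norm_num
  · rw [bernoulli_eq_zero_of_odd hn (by have := hn.pos; omega), mul_zero]

/-- The exponential generating function of the modified Bernoulli numbers. -/
noncomputable def barSeries : ℚ⟦X⟧ :=
  PowerSeries.mk fun n => bernoulliBar n / n.factorial

/-- The series `sinh (x / 2) / (x / 2)`. -/
noncomputable def sinhcSeries : ℚ⟦X⟧ :=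
  PowerSeries.mk fun n => ((1 / 2 : ℚ) ^ (n + 1) - (-1 / 2) ^ (n + 1)) / (n + 1).factorial

/-- The logarithm of `sinh (x / 2) / (x / 2)`. -/
noncomputable def logSinhcSeries : ℚ⟦X⟧ :=
  PowerSeries.mk fun n => if n < 2 then 0 else bernoulli n / (n * n.factorial)

theorem exp_half_mul_exp_neg_half :
    rescale (1 / 2) (exp ℚ) * rescale (-1 / 2) (exp ℚ) = 1 := by
  rw [exp_mul_exp_eq_exp_add]
  norm_num

theorem constantCoeff_rescale_exp (a : ℚ) : constantCoeff (rescale a (exp ℚ)) = 1 := by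
  rw [← coeff_zero_eq_constantCoeff_apply, coeff_rescale]
  simp

theorem two_eq_C : (2 : ℚ⟦X⟧) = C 2 := (map_ofNat C 2).symm

theorem exp_half_sq : rescale (1 / 2) (exp ℚ) ^ 2 = exp ℚ := by
  rw [rescale_exp_pow]
  norm_num

theorem exp_neg_half_mul_exp :
    rescale (-1 / 2) (exp ℚ) * exp ℚ = rescale (1 / 2) (exp ℚ) := by
  have h : rescale (1 : ℚ) (exp ℚ) = exp ℚ := by simp
  nth_rewrite 2 [← h]
  rw [exp_mul_exp_eq_exp_add]
  norm_num

theorem exp_half_sub_exp_neg_half :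
    rescale (1 / 2) (exp ℚ) - rescale (-1 / 2) (exp ℚ) =
      rescale (-1 / 2) (exp ℚ) * (exp ℚ - 1) := by
  rw [mul_sub, exp_neg_half_mul_exp, mul_one]

theorem X_mul_sinhcSeries :
    X * sinhcSeries = rescale (1 / 2) (exp ℚ) - rescale (-1 / 2) (exp ℚ) := by
  ext n
  cases n with
  | zero => simp [constantCoeff_rescale_exp]
  | succ n =>
    rw [coeff_succ_X_mul, map_sub, coeff_rescale, coeff_rescale, coeff_exp, sinhcSeries, coeff_mk]
    simp
    ring

theorem barSeries_eq :
    barSeries = 2 * rescale (1 / 2) (bernoulliPowerSeries ℚ) - bernoulliPowerSeries ℚ := by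
  ext n
  rw [map_sub, two_eq_C, coeff_C_mul, coeff_rescale, bernoulliPowerSeries, coeff_mk, barSeries, coeff_mk,
    bernoulliBar_eq]
  simp
  ring

/-- With u = e^{x/2}, this is 2(x/2)/(u-1) - x/(u²-1) = xu/(u²-1) = x/(u-u⁻¹). -/
theorem barSeries_mul_sub :
    barSeries * (rescale (1 / 2) (exp ℚ) - rescale (-1 / 2) (exp ℚ)) = X := by
  have h1 := bernoulliPowerSeries_mul_exp_sub_one ℚ
  have h2 := congrArg (rescale (1 / 2 : ℚ)) h1
  rw [map_mul, map_sub, rescale_X, map_one] at h2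
  have h3 : (2 : ℚ⟦X⟧) * C (1 / 2 : ℚ) = 1 := by
    rw [two_eq_C, ← map_mul]
    norm_num
  have h4 := exp_half_mul_exp_neg_half
  have h5 := exp_half_sq
  rw [barSeries_eq]
  set u := rescale (1 / 2 : ℚ) (exp ℚ)
  set v := rescale (-1 / 2 : ℚ) (exp ℚ)
  set b := bernoulliPowerSeries ℚ
  set b' := rescale (1 / 2 : ℚ) b
  rw [← h5] at h1
  have h6 : (2 * b' - b) * (u ^ 2 - 1) = X * u := by
    linear_combination 2 * (u + 1) * h2 - h1 + (u + 1) * X * h3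
  linear_combination v * h6 + (X - (2 * b' - b) * u) * h4

theorem barSeries_mul_sinhcSeries : barSeries * sinhcSeries = 1 := by
  apply mul_left_cancel₀ (X_ne_zero (R := ℚ))
  linear_combination barSeries_mul_sub + barSeries * X_mul_sinhcSeries

theorem derivative_sinhcSeries :
    derivative ℚ sinhcSeries = derivative ℚ logSinhcSeries * sinhcSeries := by
  -- The term x/2 cancels B₁ = -1/2 and the -1 cancels B₀, matching the cutoff n < 2 in
  -- `logSinhcSeries`.
  have hL : X * derivative ℚ logSinhcSeries =
      bernoulliPowerSeries ℚ + C (1 / 2) * X - 1 := by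
    ext n
    rcases n with _ | _ | n
    · simp [bernoulliPowerSeries]
    · rw [coeff_succ_X_mul]
      simp [bernoulliPowerSeries, coeff_derivative, logSinhcSeries, coeff_one]
      norm_num
    · rw [coeff_succ_X_mul]
      simp [bernoulliPowerSeries, coeff_derivative, logSinhcSeries, coeff_one]
      field_simp
  have h1 := congrArg (derivative ℚ) X_mul_sinhcSeries
  rw [Derivation.leibniz, map_sub, derivative_rescale_exp, derivative_rescale_exp,
    derivative_X] at h1
  have hn : C (-1 / 2 : ℚ) = -C (1 / 2 : ℚ) := by rw [← map_neg]; norm_num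
  rw [hn, smul_eq_mul, smul_eq_mul] at h1
  have h2 := bernoulliPowerSeries_mul_exp_sub_one ℚ
  have h3 := exp_half_mul_exp_neg_half
  have h4 := X_mul_sinhcSeries
  rw [← exp_half_sq] at h2
  apply mul_left_cancel₀ (pow_ne_zero 2 (X_ne_zero (R := ℚ)))
  set u := rescale (1 / 2 : ℚ) (exp ℚ)
  set v := rescale (-1 / 2 : ℚ) (exp ℚ)
  set b := bernoulliPowerSeries ℚ
  have h5 : b * (u - v) = X * v := by linear_combination v * h2 - b * u * h3
  have h6 : C (1 / 2 : ℚ) * 2 = (1 : ℚ⟦X⟧) := by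
    rw [two_eq_C, ← map_mul]
    norm_num
  linear_combination X * h1 - X * sinhcSeries * hL - (b + C (1 / 2) * X) * h4 - h5
    + X * v * h6

end Series

/-! ### Central factorial numbers and centred power sums -/

section PowerSums

theorem sub_pow_eq (k : ℕ) :
    (rescale (1 / 2) (exp ℚ) - rescale (-1 / 2) (exp ℚ)) ^ k =
      rescale (-(k : ℚ) / 2) (exp ℚ) * (exp ℚ - 1) ^ k := by
  have h : rescale (-(k : ℚ) / 2) (exp ℚ) = rescale (-1 / 2) (exp ℚ) ^ k := by
    rw [rescale_exp_pow]
    congr 2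
    ring
  rw [h, ← mul_pow, exp_half_sub_exp_neg_half]

/-- The generating function `∑ (k + 1) ⋯ (k + m) [x ^ m] (sinh (x / 2) / (x / 2)) ^ k y ^ m`
of the central factorial numbers. -/
noncomputable def centralSeries (k : ℕ) : ℚ⟦X⟧ :=
  PowerSeries.mk fun m => ((k + 1).ascFactorial m : ℚ) * coeff m (sinhcSeries ^ k)

/-- This is `prod_mul_laplace` at a = -k/2, where e^{ax}(e^x-1)^k = (xS)^k with S = sinh(x/2)/(x/2).
As (k+m)! = k!·(k+1)⋯(k+m), the transform of (xS)^k is k! X^k times the central series. -/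
theorem prod_mul_centralSeries (k : ℕ) :
    (∏ j ∈ range (k + 1), (1 - C (-(k : ℚ) / 2 + j) * X)) * centralSeries k = 1 := by
  have h := prod_mul_laplace k (-(k : ℚ) / 2)
  have h1 : laplace (rescale (-(k : ℚ) / 2) (exp ℚ) * (exp ℚ - 1) ^ k) =
      C (k.factorial : ℚ) * X ^ k * centralSeries k := by
    rw [← sub_pow_eq, ← X_mul_sinhcSeries, mul_pow]
    ext n
    rw [mul_assoc, coeff_C_mul, laplace, coeff_mk, coeff_X_pow_mul', coeff_X_pow_mul']
    split_ifs with hkn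
    · obtain ⟨m, rfl⟩ := Nat.exists_eq_add_of_le hkn
      rw [centralSeries, coeff_mk, Nat.add_sub_cancel_left, ← Nat.factorial_mul_ascFactorial]
      push_cast
      ring
    · simp
  rw [h1] at h
  have h2 : C (k.factorial : ℚ) * X ^ k ≠ 0 :=
    mul_ne_zero ((map_ne_zero_iff C C_injective).2 (by positivity)) (pow_ne_zero _ X_ne_zero)
  apply mul_left_cancel₀ h2
  linear_combination h

/-- The geometric sum of the symmetric exponents is sinh((k+1)x/2)/sinh(x/2), and `barSeries` is
x/(2 sinh(x/2)). -/
theorem X_mul_sum_rescale_exp (k : ℕ) :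
    X * ∑ j ∈ range (k + 1), rescale (-(k : ℚ) / 2 + j) (exp ℚ) =
      barSeries * (rescale (((k : ℚ) + 1) * (1 / 2)) (exp ℚ) -
        rescale (((k : ℚ) + 1) * (-1 / 2)) (exp ℚ)) := by
  have h1 : ∑ j ∈ range (k + 1), rescale (-(k : ℚ) / 2 + j) (exp ℚ) =
      rescale (-1 / 2) (exp ℚ) ^ k * ∑ j ∈ range (k + 1), exp ℚ ^ j := by
    rw [mul_sum]
    refine sum_congr rfl fun j _ => ?_
    rw [exp_pow_eq_rescale_exp, rescale_exp_pow, exp_mul_exp_eq_exp_add]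
    congr 2
    ring
  have h2 : ∀ a : ℚ, rescale (((k : ℚ) + 1) * a) (exp ℚ) = rescale a (exp ℚ) ^ (k + 1) := by
    intro a
    rw [rescale_exp_pow]
    push_cast
    rfl
  rw [h1, h2, h2]
  have h3 := geom_sum_mul (exp ℚ) (k + 1)
  have h4 := barSeries_mul_sub
  have h6 : rescale (-1 / 2) (exp ℚ) ^ (k + 1) * exp ℚ ^ (k + 1) =
      rescale (1 / 2) (exp ℚ) ^ (k + 1) := by
    rw [← mul_pow, exp_neg_half_mul_exp]
  rw [← h6]
  rw [exp_half_sub_exp_neg_half] at h4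
  set v := rescale (-1 / 2 : ℚ) (exp ℚ)
  set G := ∑ j ∈ range (k + 1), exp ℚ ^ j
  linear_combination (-v ^ k * G) * h4 + barSeries * v ^ (k + 1) * h3

/-- The polynomial whose value at `k + 1` is `∑_{j ≤ k} (j - k / 2) ^ r`. -/
noncomputable def powerSumPoly (r : ℕ) : Polynomial ℚ :=
  ∑ i ∈ range (r + 1), Polynomial.monomial (i + 1)
    (r.factorial * (((1 / 2 : ℚ) ^ (i + 1) - (-1 / 2) ^ (i + 1)) / (i + 1).factorial *
      (bernoulliBar (r - i) / (r - i).factorial)))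

/-- Compare coefficients of x^r in `X_mul_sum_rescale_exp`: the dependence on k enters only through
sinh((k+1)x/2), hence through odd powers of k+1. -/
theorem eval_powerSumPoly (r k : ℕ) :
    (powerSumPoly r).eval ((k : ℚ) + 1) = ∑ j ∈ range (k + 1), (-(k : ℚ) / 2 + j) ^ r := by
  have h0 : rescale (((k : ℚ) + 1) * (1 / 2)) (exp ℚ) - rescale (((k : ℚ) + 1) * (-1 / 2)) (exp ℚ)
      = X * PowerSeries.mk fun i => ((k : ℚ) + 1) ^ (i + 1) *
        (((1 / 2 : ℚ) ^ (i + 1) - (-1 / 2) ^ (i + 1)) / (i + 1).factorial) := by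
    ext n
    cases n with
    | zero => simp [constantCoeff_rescale_exp]
    | succ n =>
      rw [coeff_succ_X_mul, map_sub, coeff_rescale, coeff_rescale, coeff_exp, coeff_mk, mul_pow,
        mul_pow]
      simp
      ring
  have h := X_mul_sum_rescale_exp k
  rw [h0, mul_left_comm] at h
  have h1 := congrArg (coeff r) (mul_left_cancel₀ X_ne_zero h)
  rw [mul_comm, coeff_mul, Nat.sum_antidiagonal_eq_sum_range_succ_mk, map_sum] at h1
  have hr : (r.factorial : ℚ) ≠ 0 := by positivity
  have h2 : ∑ j ∈ range (k + 1), (-(k : ℚ) / 2 + j) ^ r = r.factorial *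
      ∑ j ∈ range (k + 1), coeff r (rescale (-(k : ℚ) / 2 + j) (exp ℚ)) := by
    rw [mul_sum]
    refine sum_congr rfl fun j _ => ?_
    rw [coeff_rescale, coeff_exp]
    simp
    field_simp
  rw [h2, h1, powerSumPoly, Polynomial.eval_finsetSum, mul_sum]
  refine sum_congr rfl fun i _ => ?_
  rw [Polynomial.eval_monomial, coeff_mk, barSeries, coeff_mk]
  ring

theorem coeff_zero_powerSumPoly (r : ℕ) : (powerSumPoly r).coeff 0 = 0 := by
  simp [powerSumPoly, Polynomial.coeff_monomial]

theorem coeff_succ_powerSumPoly (r i : ℕ) :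
    (powerSumPoly r).coeff (i + 1) = if i ≤ r then
      r.factorial * (((1 / 2 : ℚ) ^ (i + 1) - (-1 / 2) ^ (i + 1)) / (i + 1).factorial *
      (bernoulliBar (r - i) / (r - i).factorial)) else 0 := by
  simp only [powerSumPoly, Polynomial.finsetSum_coeff, Polynomial.coeff_monomial,
    Nat.add_right_cancel_iff, sum_ite_eq', mem_range, Nat.lt_succ_iff]

end PowerSums

/-! ### Interpolation in the exponent by polynomial coefficients -/

section Interpolation

/-- The series `∑ B̄ₙ xⁿ / n`. -/
noncomputable def barLogSeries : ℚ⟦X⟧ :=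
  PowerSeries.mk fun n => bernoulliBar n / n

/-- The series `∑ (n - 1) B̄ₙ₋₂ xⁿ / 24`. -/
noncomputable def cubicSeries : ℚ⟦X⟧ :=
  PowerSeries.mk fun n => if n < 2 then 0 else ((n : ℚ) - 1) / 24 * bernoulliBar (n - 2)

/-- F is the exponential of ∑ p_r(t) y^r/r, with p_r the power sum polynomials. At t = k+1 it has
the same logarithmic derivative and constant term as the inverse product, hence equals it. -/
theorem exists_centralSeries_poly :
    ∃ F : (Polynomial ℚ)⟦X⟧,
      (∀ k : ℕ, PowerSeries.map (Polynomial.evalRingHom ((k : ℚ) + 1)) F = centralSeries k) ∧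
      6 * slice 3 F = barLogSeries ^ 3 + 6 * cubicSeries := by
  set B : (Polynomial ℚ)⟦X⟧ := PowerSeries.mk fun n => Polynomial.C (1 / (n : ℚ)) * powerSumPoly n
    with hB
  have hB0 : constantCoeff B = 0 := by
    -- The constant term vanishes since 1/0 = 0.
    rw [← coeff_zero_eq_constantCoeff_apply, hB, coeff_mk]
    simp
  have hB' : derivative _ B = PowerSeries.mk fun r => powerSumPoly (r + 1) := by
    ext1 r
    have h1 : ((r : Polynomial ℚ) + 1) = Polynomial.C ((r : ℚ) + 1) := by simp
    have h2 : (r : ℚ) + 1 ≠ 0 := by positivity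
    rw [coeff_derivative, hB, coeff_mk, coeff_mk, h1, mul_right_comm, ← map_mul]
    push_cast
    rw [one_div_mul_cancel h2, map_one, one_mul]
  obtain ⟨F, hF0, hF⟩ := exists_derivative_eq_mul hB0
  refine ⟨F, fun k => ?_, ?_⟩
  · apply eq_of_derivative_eq_mul
      (A := PowerSeries.mk fun r => ∑ j ∈ range (k + 1), (-(k : ℚ) / 2 + j) ^ (r + 1))
    · rw [← map_derivative, hF, map_mul, hB']
      congr 1
      ext r
      rw [coeff_map, coeff_mk, coeff_mk, Polynomial.coe_evalRingHom, eval_powerSumPoly]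
    · exact derivative_eq_of_prod_mul_eq_one _ _ (prod_mul_centralSeries k)
    · have h1 := congrArg constantCoeff (prod_mul_centralSeries k)
      rw [map_mul, map_prod] at h1
      simp at h1
      rw [h1, ← coeff_zero_eq_constantCoeff_apply, coeff_map, coeff_zero_eq_constantCoeff_apply,
        hF0, map_one]
  · refine (slices_of_derivative_eq_mul (φ := barLogSeries) (χ := cubicSeries)
      hF0 hF ?_ ?_ ?_ ?_ ?_ ?_).2.2.2
    · ext r
      rw [hB', coeff_slice, coeff_mk, coeff_zero_powerSumPoly, map_zero]
    · ext r
      rw [hB', coeff_slice, coeff_mk, coeff_succ_powerSumPoly, coeff_derivative, barLogSeries,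
        coeff_mk, if_pos (Nat.zero_le _)]
      have h1 : ((r + 1).factorial : ℚ) ≠ 0 := by positivity
      push_cast
      field_simp
      norm_num
    -- The t²-coefficient vanishes because (1/2)² = (-1/2)².
    · ext r
      rw [hB', coeff_slice, coeff_mk, coeff_succ_powerSumPoly]
      norm_num
    -- The 24 in `cubicSeries` is 3!·4, from ((1/2)³ - (-1/2)³)/3! = 1/24.
    · ext r
      rw [hB', coeff_slice, coeff_mk, coeff_succ_powerSumPoly, coeff_derivative, cubicSeries,
        coeff_mk]
      rcases r with _ | r
      · norm_num
      · have h1 : (r.factorial : ℚ) ≠ 0 := by positivity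
        rw [if_pos (by omega), if_neg (by omega), show r + 1 + 1 - 2 = r by omega,
          Nat.factorial_succ (r + 1), Nat.factorial_succ r]
        push_cast
        field_simp
        norm_num [Nat.factorial]
        ring
    · rw [← coeff_zero_eq_constantCoeff_apply, barLogSeries, coeff_mk]
      simp
    · rw [← coeff_zero_eq_constantCoeff_apply, cubicSeries, coeff_mk]
      simp

/-- E = exp(tL) with L = log S interpolates the powers S^k, and its t^j-coefficient is L^j/j!. -/
theorem exists_sinhcSeries_pow_poly :
    ∃ E : (Polynomial ℚ)⟦X⟧,
      (∀ k : ℕ, PowerSeries.map (Polynomial.evalRingHom (k : ℚ)) E = sinhcSeries ^ k) ∧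
      slice 0 E = 1 ∧ slice 1 E = logSinhcSeries ∧ 2 * slice 2 E = logSinhcSeries ^ 2 := by
  set B : (Polynomial ℚ)⟦X⟧ := C Polynomial.X * PowerSeries.map Polynomial.C logSinhcSeries
    with hB
  have hL0 : constantCoeff logSinhcSeries = 0 := by
    rw [← coeff_zero_eq_constantCoeff_apply, logSinhcSeries, coeff_mk]
    simp
  have hB0 : constantCoeff B = 0 := by
    rw [hB, map_mul, ← coeff_zero_eq_constantCoeff_apply (PowerSeries.map _ _), coeff_map,
      coeff_zero_eq_constantCoeff_apply, hL0]
    simp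
  have hB' : derivative _ B =
      C Polynomial.X * PowerSeries.map Polynomial.C (derivative ℚ logSinhcSeries) := by
    ext1 r
    have h1 : ((r : Polynomial ℚ) + 1) = Polynomial.C ((r : ℚ) + 1) := by simp
    rw [coeff_derivative, hB, coeff_C_mul, coeff_C_mul, coeff_map, coeff_map, coeff_derivative,
      h1, mul_assoc, ← map_mul]
  have hBs : ∀ j, slice j (derivative _ B) = if j = 1 then derivative ℚ logSinhcSeries else 0 := by
    intro j
    ext r
    rw [hB', coeff_slice, coeff_C_mul, coeff_map]
    rcases j with _ | _ | j <;> simp [Polynomial.coeff_C]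
  obtain ⟨E, hE0, hE⟩ := exists_derivative_eq_mul hB0
  refine ⟨E, fun k => ?_, ?_⟩
  · apply eq_of_derivative_eq_mul (A := C (k : ℚ) * derivative ℚ logSinhcSeries)
    · rw [← map_derivative, hE, map_mul, hB', map_mul]
      congr 2
      · simp
      · ext r
        simp
    · rw [Derivation.leibniz_pow, derivative_sinhcSeries]
      cases k with
      | zero => simp
      | succ k =>
        simp
        ring
    · have h1 : constantCoeff sinhcSeries = 1 := by
        rw [← coeff_zero_eq_constantCoeff_apply, sinhcSeries, coeff_mk]
        norm_num
      rw [map_pow, h1, ← coeff_zero_eq_constantCoeff_apply, coeff_map,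
        coeff_zero_eq_constantCoeff_apply, hE0, map_one, one_pow]
  · have h := slices_of_derivative_eq_mul (φ := logSinhcSeries) (χ := 0)
      hE0 hE (by simp [hBs]) (by simp [hBs]) (by simp [hBs]) (by simp [hBs]) hL0 (map_zero _)
    exact ⟨h.1, h.2.1, h.2.2.1⟩

end Interpolation

/-! ### Low coefficients of the rising factorial -/

section Harmonic

theorem harmonicTwo_succ (N : ℕ) :
    harmonicTwo (N + 1) = harmonicTwo N + harmonic N / ((N : ℚ) + 1) := by
  have h : ∀ M, harmonicTwo M =
      ∑ i ∈ Icc 1 M, ∑ j ∈ Icc 1 M, if i < j then 1 / ((i : ℚ) * (j : ℚ)) else 0 := by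
    intro M
    rw [harmonicTwo, sum_filter, sum_product]
  have h1 : ∑ j ∈ Icc 1 (N + 1), (if N + 1 < j then 1 / (((N + 1 : ℕ) : ℚ) * (j : ℚ)) else 0) = 0 :=
    sum_eq_zero fun j hj => if_neg (by have := mem_Icc.1 hj; omega)
  rw [h, h, sum_Icc_succ_top (by omega), h1, add_zero, harmonic_eq_sum_Icc, sum_div,
    ← sum_add_distrib]
  refine sum_congr rfl fun i hi => ?_
  rw [sum_Icc_succ_top (by omega), if_pos (by have := mem_Icc.1 hi; omega)]
  push_cast
  rw [one_div, mul_inv, div_eq_mul_inv]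

/-- t(t+1)⋯(t+m) = m!·t·∏_{i≤m}(1+t/i), so the coefficients are elementary symmetric functions of
the 1/i. -/
theorem coeff_ascPochhammer_succ (m : ℕ) :
    (ascPochhammer ℚ (m + 1)).coeff 0 = 0 ∧ (ascPochhammer ℚ (m + 1)).coeff 1 = m.factorial ∧
      (ascPochhammer ℚ (m + 1)).coeff 2 = m.factorial * harmonic m ∧
      (ascPochhammer ℚ (m + 1)).coeff 3 = m.factorial * harmonicTwo m := by
  induction m with
  | zero => simp [harmonicTwo, Polynomial.coeff_X]
  | succ m ih =>
    obtain ⟨h0, h1, h2, h3⟩ := ih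
    have hm : (m : ℚ) + 1 ≠ 0 := by positivity
    rw [ascPochhammer_succ_right]
    have hs : ∀ j, (ascPochhammer ℚ (m + 1) * (Polynomial.X + ((m + 1 : ℕ) : Polynomial ℚ))).coeff
        (j + 1) = (ascPochhammer ℚ (m + 1)).coeff j +
          (ascPochhammer ℚ (m + 1)).coeff (j + 1) * ((m : ℚ) + 1) := by
      intro j
      rw [mul_add, Polynomial.coeff_add, Polynomial.coeff_mul_X, Polynomial.coeff_mul_natCast]
      push_cast
      rfl
    refine ⟨?_, ?_, ?_, ?_⟩
    · rw [mul_add, Polynomial.coeff_add, Polynomial.coeff_mul_X_zero, Polynomial.coeff_mul_natCast,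
        h0]
      simp
    · rw [hs, h0, h1, Nat.factorial_succ]
      push_cast
      ring
    · rw [hs, h1, h2, Nat.factorial_succ, harmonic_succ]
      push_cast
      field_simp
      ring
    · rw [hs, h2, h3, Nat.factorial_succ, harmonicTwo_succ]
      push_cast
      field_simp
      ring

end Harmonic

/-! ### Comparing coefficients of t³ -/

section Comparison

/-- The cubic convolution identity in terms of generating functions. -/
theorem coeff_barLogSeries_pow_three (m : ℕ) :
    coeff (m + 1) (barLogSeries ^ 3) + 6 * coeff (m + 1) cubicSeries =
      m.factorial * (3 * coeff (m + 1) (logSinhcSeries ^ 2 * barSeries) +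
        6 * harmonic m * coeff (m + 1) (logSinhcSeries * barSeries) +
        6 * harmonicTwo m * coeff (m + 1) barSeries) := by
  obtain ⟨F, hF, hF3⟩ := exists_centralSeries_poly
  obtain ⟨E, hE, hE0, hE1, hE2⟩ := exists_sinhcSeries_pow_poly
  set G := E * PowerSeries.map Polynomial.C barSeries with hG
  have hGs : ∀ j, slice j G = slice j E * barSeries := by
    intro j
    rw [hG, slice_mul, sum_eq_single (j, 0)]
    · rw [slice_map_C_zero]
    · rintro ⟨a, b⟩ hab hne
      rw [HasAntidiagonal.mem_antidiagonal] at hab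
      have hb : b ≠ 0 := by
        rintro rfl
        exact hne (by simpa using hab)
      rw [slice_map_C_of_ne_zero hb, mul_zero]
    · simp
  -- Both sides are polynomials in t; it is enough to check t = k+1 for all natural k, where G
  -- becomes S^{k+1}/S = S^k.
  have hFG : coeff (m + 1) F = ascPochhammer ℚ (m + 1) * coeff (m + 1) G := by
    apply Polynomial.eq_of_infinite_eval_eq
    refine Set.Infinite.mono ?_ (Set.infinite_range_of_injective
      (f := fun k : ℕ => (k : ℚ) + 1) fun a b h => by simpa using h)
    rintro _ ⟨k, rfl⟩
    have h1 := congrArg (coeff (m + 1)) (hF k)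
    rw [coeff_map, Polynomial.coe_evalRingHom, centralSeries, coeff_mk] at h1
    have h2 : PowerSeries.map (Polynomial.evalRingHom ((k : ℚ) + 1)) G = sinhcSeries ^ k := by
      have h3 := hE (k + 1)
      have h4 : PowerSeries.map (Polynomial.evalRingHom ((k : ℚ) + 1))
          (PowerSeries.map Polynomial.C barSeries) = barSeries := by
        ext r
        simp
      push_cast at h3
      rw [hG, map_mul, h3, h4, pow_succ]
      linear_combination sinhcSeries ^ k * barSeries_mul_sinhcSeries
    have h5 := congrArg (coeff (m + 1)) h2
    rw [coeff_map, Polynomial.coe_evalRingHom] at h5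
    have h6 := ascPochhammer_nat_eq_natCast_ascFactorial ℚ (k + 1) (m + 1)
    push_cast at h6
    rw [Set.mem_ofPred_eq, Polynomial.eval_mul, h1, h5, h6]
  have h3 := congrArg (coeff (m + 1)) hF3
  have hC : (6 : ℚ⟦X⟧) = C 6 := (map_ofNat C 6).symm
  have hG2 : 2 * slice 2 G = logSinhcSeries ^ 2 * barSeries := by
    rw [hGs]
    linear_combination barSeries * hE2
  have hG2' := congrArg (coeff (m + 1)) hG2
  have hG1 := congrArg (coeff (m + 1)) (hGs 1)
  have hG0 := congrArg (coeff (m + 1)) (hGs 0)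
  rw [two_eq_C, coeff_C_mul, coeff_slice] at hG2'
  rw [coeff_slice, hE1] at hG1
  rw [coeff_slice, hE0, one_mul] at hG0
  rw [hC, coeff_C_mul, map_add, coeff_C_mul, coeff_slice, hFG, Polynomial.coeff_mul] at h3
  obtain ⟨a0, a1, a2, a3⟩ := coeff_ascPochhammer_succ m
  simp only [Nat.antidiagonal_succ, Nat.antidiagonal_zero, map_singleton, sum_cons, sum_singleton,
    map_cons, Function.Embedding.prodMap, Function.Embedding.coeFn_mk, Prod.map,
    Function.Embedding.refl_apply, Nat.succ_eq_add_one, zero_add, Nat.reduceAdd] at h3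
  rw [a0, a1, a2, a3, hG1, hG0] at h3
  linear_combination -h3 + 3 * (m.factorial : ℚ) * hG2'

end Comparison

/-! ### Convolutions of even series as sums over positive indices -/

section Reindexing

theorem coeff_two_mul_mul {f g : ℚ⟦X⟧} (hf : ∀ n, Odd n → coeff n f = 0) (n : ℕ) :
    coeff (2 * n) (f * g) =
      ∑ p ∈ antidiagonal n, coeff (2 * p.1) f * coeff (2 * p.2) g := by
  rw [coeff_mul]
  symm
  refine sum_of_injOn (fun p => (2 * p.1, 2 * p.2)) ?_ ?_ ?_ ?_
  · rintro ⟨a, b⟩ _ ⟨c, d⟩ _ h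
    simpa using h
  · rintro ⟨a, b⟩ h
    simp only [mem_coe, HasAntidiagonal.mem_antidiagonal] at h ⊢
    omega
  · rintro ⟨a, b⟩ h hn
    rcases Nat.even_or_odd' a with ⟨c, rfl | rfl⟩
    · refine absurd ⟨(c, n - c), ?_, ?_⟩ hn
      · simp only [mem_coe, HasAntidiagonal.mem_antidiagonal] at h ⊢
        omega
      · simp only [HasAntidiagonal.mem_antidiagonal, Prod.mk.injEq, true_and] at h ⊢
        omega
    · rw [hf _ (odd_two_mul_add_one c), zero_mul]
  · intros
    rfl

theorem coeff_mul_eq_zero_of_odd {f g : ℚ⟦X⟧} (hf : ∀ n, Odd n → coeff n f = 0)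
    (hg : ∀ n, Odd n → coeff n g = 0) (n : ℕ) (hn : Odd n) : coeff n (f * g) = 0 := by
  rw [coeff_mul]
  refine sum_eq_zero fun p hp => ?_
  rw [HasAntidiagonal.mem_antidiagonal] at hp
  rcases Nat.even_or_odd p.1 with h | h
  · rw [hg p.2, mul_zero]
    rw [← hp] at hn
    exact (Nat.odd_add'.1 hn).2 h
  · rw [hf _ h, zero_mul]

theorem coeff_two_mul_mul_mul {f g h : ℚ⟦X⟧} (hf : ∀ n, Odd n → coeff n f = 0)
    (hg : ∀ n, Odd n → coeff n g = 0) (n : ℕ) :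
    coeff (2 * n) (f * g * h) = ∑ p ∈ antidiagonal n, ∑ q ∈ antidiagonal p.1,
      coeff (2 * q.1) f * coeff (2 * q.2) g * coeff (2 * p.2) h := by
  rw [coeff_two_mul_mul (coeff_mul_eq_zero_of_odd hf hg)]
  refine sum_congr rfl fun p _ => ?_
  rw [coeff_two_mul_mul hf, sum_mul]

theorem sum_antidiagonal_eq_sum_Icc {n : ℕ} (hn : 1 ≤ n) (g : ℕ → ℕ → ℚ) (h0 : ∀ l, g 0 l = 0) :
    ∑ p ∈ antidiagonal n, g p.1 p.2 = ∑ k ∈ Icc 1 (n - 1), g k (n - k) + g n 0 := by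
  obtain ⟨n, rfl⟩ := Nat.exists_eq_add_of_le' hn
  rw [Nat.sum_antidiagonal_eq_sum_range_succ_mk, sum_range_succ, range_eq_Ico,
    sum_eq_sum_Ico_succ_bot (by omega), h0, zero_add, Nat.sub_self]
  rfl

/-- In the application the summands with a zero index vanish through division by zero. -/
theorem sum_antidiagonal_antidiagonal_eq_sum_positiveTriples (n : ℕ) (f : ℕ → ℕ → ℕ → ℚ)
    (h1 : ∀ l m, f 0 l m = 0) (h2 : ∀ k m, f k 0 m = 0) (h3 : ∀ k l, f k l 0 = 0) :
    ∑ p ∈ antidiagonal n, ∑ q ∈ antidiagonal p.1, f q.1 q.2 p.2 =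
      ∑ t ∈ positiveTriples n, f t.1 t.2.1 t.2.2 := by
  rw [sum_sigma']
  symm
  refine sum_of_injOn (fun t => ⟨(t.1 + t.2.1, t.2.2), (t.1, t.2.1)⟩) ?_ ?_ ?_ ?_
  · rintro ⟨a, b, c⟩ _ ⟨a', b', c'⟩ _ h
    simp only [Sigma.mk.injEq, Prod.mk.injEq, heq_eq_eq] at h ⊢
    omega
  · rintro ⟨a, b, c⟩ h
    simp only [positiveTriples, coe_filter, mem_product, mem_Icc, Set.mem_ofPred_eq] at h
    simp only [coe_sigma, Set.mem_sigma_iff, mem_coe, HasAntidiagonal.mem_antidiagonal,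
      and_true]
    omega
  · rintro ⟨⟨s, c⟩, ⟨a, b⟩⟩ h hn
    simp only [mem_sigma, HasAntidiagonal.mem_antidiagonal] at h
    obtain ⟨h, rfl⟩ := h
    rcases Nat.eq_zero_or_pos a with rfl | ha
    · exact h1 _ _
    rcases Nat.eq_zero_or_pos b with rfl | hb
    · exact h2 _ _
    rcases Nat.eq_zero_or_pos c with rfl | hc
    · exact h3 _ _
    refine absurd ⟨(a, b, c), ?_, rfl⟩ hn
    simp only [positiveTriples, coe_filter, mem_product, mem_Icc, Set.mem_ofPred_eq]
    omega
  · intros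
    rfl

/-- Variant for a third factor with nonzero constant term, such as `barSeries`: the terms with third
index 0 survive as a boundary sum. -/
theorem sum_antidiagonal_antidiagonal_eq_add {n : ℕ} (hn : 1 ≤ n) (f : ℕ → ℕ → ℕ → ℚ)
    (h1 : ∀ l m, f 0 l m = 0) (h2 : ∀ k m, f k 0 m = 0) :
    ∑ p ∈ antidiagonal n, ∑ q ∈ antidiagonal p.1, f q.1 q.2 p.2 =
      ∑ t ∈ positiveTriples n, f t.1 t.2.1 t.2.2 + ∑ k ∈ Icc 1 (n - 1), f k (n - k) 0 := by
  have hs : ∑ t ∈ positiveTriples n, f t.1 t.2.1 t.2.2 =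
      ∑ p ∈ antidiagonal n, ∑ q ∈ antidiagonal p.1, if p.2 = 0 then 0 else f q.1 q.2 p.2 := by
    rw [sum_antidiagonal_antidiagonal_eq_sum_positiveTriples n
      (fun a b c => if c = 0 then 0 else f a b c) (by simp [h1]) (by simp [h2]) (by simp)]
    refine sum_congr rfl fun t ht => ?_
    simp only [positiveTriples, mem_filter, mem_product, mem_Icc] at ht
    rw [if_neg (by omega)]
  have he : ∑ k ∈ Icc 1 (n - 1), f k (n - k) 0 =
      ∑ p ∈ antidiagonal n, ∑ q ∈ antidiagonal p.1, if p.2 = 0 then f q.1 q.2 p.2 else 0 := by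
    rw [sum_eq_single (n, 0)]
    · have := sum_antidiagonal_eq_sum_Icc hn (fun k l => f k l 0) (fun l => h1 l 0)
      simp only [h2, add_zero] at this
      simpa using this.symm
    · rintro ⟨a, b⟩ hab hne
      rw [HasAntidiagonal.mem_antidiagonal] at hab
      have hb : b ≠ 0 := by
        rintro rfl
        exact hne (by simpa using hab)
      simp [hb]
    · simp
  rw [hs, he, ← sum_add_distrib]
  refine sum_congr rfl fun p _ => ?_
  rw [← sum_add_distrib]
  refine sum_congr rfl fun q _ => ?_
  split_ifs <;> simp

theorem trinomial_eq (a b c : ℕ) : (trinomial a b c : ℚ) =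
    (a + b + c).factorial / (a.factorial * b.factorial * c.factorial) := by
  have h := Nat.multinomial_spec Finset.univ ![a, b, c]
  rw [Fin.prod_univ_three, Fin.sum_univ_three] at h
  simp only [Matrix.cons_val] at h
  rw [eq_div_iff (by positivity), mul_comm, trinomial]
  exact_mod_cast h

/-- Partial fractions n/(k(n-k)) = 1/k + 1/(n-k), followed by the reflection k ↦ n-k. -/
theorem sum_div_mul_sub_eq {n : ℕ} (w : ℕ → ℚ) (hw : ∀ k ∈ Icc 1 (n - 1), w (n - k) = w k) :
    (n : ℚ) * ∑ k ∈ Icc 1 (n - 1), w k / ((k : ℚ) * ((n - k : ℕ) : ℚ)) =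
      2 * ∑ k ∈ Icc 1 (n - 1), w k / (k : ℚ) := by
  have h : ∑ k ∈ Icc 1 (n - 1), w k / ((n - k : ℕ) : ℚ) = ∑ k ∈ Icc 1 (n - 1), w k / (k : ℚ) := by
    refine sum_nbij' (fun k => n - k) (fun k => n - k) ?_ ?_ ?_ ?_ ?_
    · intro k hk
      simp only [mem_Icc] at hk ⊢
      omega
    · intro k hk
      simp only [mem_Icc] at hk ⊢
      omega
    · intro k hk
      simp only [mem_Icc] at hk
      omega
    · intro k hk
      simp only [mem_Icc] at hk
      omega
    · intro k hk
      rw [hw k hk]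
  rw [two_mul]
  nth_rewrite 1 [← h]
  rw [mul_sum, ← sum_add_distrib]
  refine sum_congr rfl fun k hk => ?_
  rw [mem_Icc] at hk
  have h1 : (k : ℚ) ≠ 0 := by norm_cast; omega
  have h2 : ((n - k : ℕ) : ℚ) ≠ 0 := by norm_cast; omega
  have h3 : (n : ℚ) = (k : ℚ) + ((n - k : ℕ) : ℚ) := by norm_cast; omega
  field_simp
  rw [h3]
  ring

end Reindexing

/-! ### Explicit coefficients at x^{2n} -/

section Coefficients

theorem coeff_barLogSeries_of_odd (n : ℕ) (hn : Odd n) : coeff n barLogSeries = 0 := by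
  rw [barLogSeries, coeff_mk, bernoulliBar_eq_zero_of_odd hn, zero_div]

theorem coeff_logSinhcSeries_of_odd (n : ℕ) (hn : Odd n) : coeff n logSinhcSeries = 0 := by
  rw [logSinhcSeries, coeff_mk]
  split_ifs with h
  · rfl
  · rw [bernoulli_eq_zero_of_odd hn (by omega), zero_div]

theorem coeff_two_mul_barSeries (n : ℕ) :
    coeff (2 * n) barSeries = bernoulliBar (2 * n) / (2 * n).factorial := by
  rw [barSeries, coeff_mk]

theorem coeff_two_mul_barLogSeries (n : ℕ) :
    coeff (2 * n) barLogSeries = bernoulliBar (2 * n) / (2 * (n : ℚ)) := by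
  rw [barLogSeries, coeff_mk]
  push_cast
  rfl

theorem coeff_two_mul_logSinhcSeries (n : ℕ) :
    coeff (2 * n) logSinhcSeries = bernoulli (2 * n) / (2 * (n : ℚ) * (2 * n).factorial) := by
  rw [logSinhcSeries, coeff_mk]
  rcases Nat.eq_zero_or_pos n with rfl | h
  · simp
  · rw [if_neg (by omega)]
    push_cast
    rfl

theorem coeff_barLogSeries_pow_three_eq (n : ℕ) : coeff (2 * n) (barLogSeries ^ 3) =
    ∑ t ∈ positiveTriples n,
        bernoulliBar (2 * t.1) * bernoulliBar (2 * t.2.1) * bernoulliBar (2 * t.2.2) /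
          ((2 * (t.1 : ℚ)) * (2 * (t.2.1 : ℚ)) * (2 * (t.2.2 : ℚ))) := by
  rw [pow_succ, sq, coeff_two_mul_mul_mul coeff_barLogSeries_of_odd coeff_barLogSeries_of_odd]
  simp only [coeff_two_mul_barLogSeries]
  rw [sum_antidiagonal_antidiagonal_eq_sum_positiveTriples n (fun k l m =>
    bernoulliBar (2 * k) / (2 * (k : ℚ)) * (bernoulliBar (2 * l) / (2 * (l : ℚ))) *
      (bernoulliBar (2 * m) / (2 * (m : ℚ)))) (by simp) (by simp) (by simp)]
  refine sum_congr rfl fun t _ => ?_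
  rw [div_mul_div_comm, div_mul_div_comm]

theorem choose_eq {n k : ℕ} (hk : k ≤ n) : ((2 * n).choose (2 * k) : ℚ) =
    (2 * n).factorial / ((2 * k).factorial * (2 * (n - k)).factorial) := by
  rw [Nat.cast_choose ℚ (by omega), Nat.mul_sub]

/-- The second sum is the boundary part with third index 0, where B̄₀ = 1; `sum_div_mul_sub_eq`
trades its symmetric denominator 2k·2(n-k) for 2k alone. -/
theorem coeff_logSinhcSeries_sq_mul_eq {n : ℕ} (hn : 1 ≤ n) :
    (2 * n).factorial * coeff (2 * n) (logSinhcSeries ^ 2 * barSeries) =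
    ∑ t ∈ positiveTriples n,
            bernoulli (2 * t.1) * bernoulli (2 * t.2.1) * bernoulliBar (2 * t.2.2) /
              ((2 * (t.1 : ℚ)) * (2 * (t.2.1 : ℚ))) *
              (trinomial (2 * t.1) (2 * t.2.1) (2 * t.2.2) : ℚ) +
      1 / n * ∑ k ∈ Icc 1 (n - 1),
            (Nat.choose (2 * n) (2 * k) : ℚ) * (bernoulli (2 * k) / (2 * (k : ℚ))) *
              bernoulli (2 * n - 2 * k) := by
  rw [sq, coeff_two_mul_mul_mul coeff_logSinhcSeries_of_odd coeff_logSinhcSeries_of_odd]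
  simp only [coeff_two_mul_logSinhcSeries, coeff_two_mul_barSeries]
  rw [sum_antidiagonal_antidiagonal_eq_add hn (fun k l m =>
    bernoulli (2 * k) / (2 * (k : ℚ) * (2 * k).factorial) *
      (bernoulli (2 * l) / (2 * (l : ℚ) * (2 * l).factorial)) *
      (bernoulliBar (2 * m) / (2 * m).factorial)) (by simp) (by simp), mul_add, mul_sum]
  congr 1
  · refine sum_congr rfl fun t ht => ?_
    simp only [positiveTriples, mem_filter] at ht
    rw [trinomial_eq, ← mul_add, ← mul_add, ht.2, div_mul_div_comm, div_mul_div_comm,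
      div_mul_div_comm, ← mul_div_assoc]
    congr 1 <;> ring
  · have hn0 : (n : ℚ) ≠ 0 := by norm_cast; omega
    have h := sum_div_mul_sub_eq (n := n) (fun k => (Nat.choose (2 * n) (2 * k) : ℚ) *
      bernoulli (2 * k) * bernoulli (2 * (n - k))) (by
        intro k hk
        rw [mem_Icc] at hk
        have h1 : n - (n - k) = k := by omega
        rw [h1, choose_eq (by omega), choose_eq (by omega), h1]
        ring)
    have h1 : ∑ k ∈ Icc 1 (n - 1), (Nat.choose (2 * n) (2 * k) : ℚ) *
        (bernoulli (2 * k) / (2 * (k : ℚ))) * bernoulli (2 * n - 2 * k) =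
        1 / 2 * ∑ k ∈ Icc 1 (n - 1), (Nat.choose (2 * n) (2 * k) : ℚ) *
          bernoulli (2 * k) * bernoulli (2 * (n - k)) / (k : ℚ) := by
      rw [mul_sum]
      refine sum_congr rfl fun k _ => ?_
      rw [Nat.mul_sub]
      field_simp
    have h2 : (2 * n).factorial * ∑ k ∈ Icc 1 (n - 1),
        bernoulli (2 * k) / (2 * (k : ℚ) * (2 * k).factorial) *
        (bernoulli (2 * (n - k)) / (2 * ((n - k : ℕ) : ℚ) * (2 * (n - k)).factorial)) *
        (bernoulliBar (2 * 0) / (2 * 0).factorial) =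
        1 / 4 * ∑ k ∈ Icc 1 (n - 1), (Nat.choose (2 * n) (2 * k) : ℚ) *
          bernoulli (2 * k) * bernoulli (2 * (n - k)) / ((k : ℚ) * ((n - k : ℕ) : ℚ)) := by
      rw [mul_sum, mul_sum]
      refine sum_congr rfl fun k hk => ?_
      rw [mem_Icc] at hk
      rw [choose_eq (by omega), mul_zero, bernoulliBar_zero]
      have h3 : (k : ℚ) ≠ 0 := by norm_cast; omega
      have h4 : ((n - k : ℕ) : ℚ) ≠ 0 := by norm_cast; omega
      simp only [Nat.factorial_zero, Nat.cast_one]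
      field_simp
      ring
    rw [h1, h2, one_div_mul_eq_div (n : ℚ), eq_div_iff hn0]
    linear_combination (1 / 4) * h

theorem coeff_logSinhcSeries_mul_eq {n : ℕ} (hn : 1 ≤ n) :
    (2 * n).factorial * coeff (2 * n) (logSinhcSeries * barSeries) =
      ∑ k ∈ Icc 1 (n - 1), (Nat.choose (2 * n) (2 * k) : ℚ) *
        (bernoulli (2 * k) * bernoulliBar (2 * n - 2 * k) / (2 * (k : ℚ))) +
      bernoulli (2 * n) / (2 * (n : ℚ)) := by
  rw [coeff_two_mul_mul coeff_logSinhcSeries_of_odd]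
  simp only [coeff_two_mul_logSinhcSeries, coeff_two_mul_barSeries]
  rw [sum_antidiagonal_eq_sum_Icc hn (fun k l =>
    bernoulli (2 * k) / (2 * (k : ℚ) * (2 * k).factorial) *
      (bernoulliBar (2 * l) / (2 * l).factorial)) (by simp), mul_add, mul_sum]
  congr 1
  · refine sum_congr rfl fun k hk => ?_
    rw [mem_Icc] at hk
    rw [choose_eq (by omega), Nat.mul_sub]
    have h3 : (k : ℚ) ≠ 0 := by norm_cast; omega
    field_simp
  · have hn0 : (n : ℚ) ≠ 0 := by norm_cast; omega
    rw [mul_zero, bernoulliBar_zero]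
    simp only [Nat.factorial_zero, Nat.cast_one]
    field_simp

end Coefficients

end BernoulliCubic

theorem theorem5p3 (n : ℕ) (hn : 3 ≤ n) :
    ∑ t ∈ positiveTriples n,
        bernoulliBar (2 * t.1) * bernoulliBar (2 * t.2.1) * bernoulliBar (2 * t.2.2) /
          ((2 * (t.1 : ℚ)) * (2 * (t.2.1 : ℚ)) * (2 * (t.2.2 : ℚ))) =
      3 / (2 * (n : ℚ)) *
          ∑ t ∈ positiveTriples n,
            bernoulli (2 * t.1) * bernoulli (2 * t.2.1) * bernoulliBar (2 * t.2.2) /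
              ((2 * (t.1 : ℚ)) * (2 * (t.2.1 : ℚ))) *
              (trinomial (2 * t.1) (2 * t.2.1) (2 * t.2.2) : ℚ)
        + 3 / (n : ℚ) * harmonic (2 * n) *
          ∑ k ∈ Icc 1 (n - 1),
            (Nat.choose (2 * n) (2 * k) : ℚ) *
              (bernoulli (2 * k) * bernoulliBar (2 * n - 2 * k) / (2 * (k : ℚ)))
        + 3 / (2 * (n : ℚ) ^ 2) *
          ∑ k ∈ Icc 1 (n - 1),
            (Nat.choose (2 * n) (2 * k) : ℚ) * (bernoulli (2 * k) / (2 * (k : ℚ))) *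
              (bernoulli (2 * n - 2 * k) - bernoulliBar (2 * n - 2 * k))
        + 3 / (2 * (n : ℚ) ^ 2) * harmonic (2 * n - 1) *
            (bernoulli (2 * n) - bernoulliBar (2 * n))
        + 6 * harmonicTwo (2 * n) * (bernoulliBar (2 * n) / (2 * (n : ℚ)))
        - (2 * (n : ℚ) - 1) / 4 * bernoulliBar (2 * n - 2) := by
  have hn1 : 1 ≤ n := by omega
  have hn0 : (n : ℚ) ≠ 0 := by norm_cast; omega
  obtain ⟨m, hm⟩ : ∃ m, 2 * n = m + 1 := ⟨2 * n - 1, by omega⟩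
  have hm' : 2 * n - 1 = m := by omega
  have hmq : (m : ℚ) + 1 = 2 * n := by exact_mod_cast hm.symm
  have h := BernoulliCubic.coeff_barLogSeries_pow_three m
  have hf : ((2 * n).factorial : ℚ) = 2 * n * m.factorial := by
    rw [hm, Nat.factorial_succ, Nat.cast_mul, Nat.cast_succ, hmq]
  have hf0 : (m.factorial : ℚ) ≠ 0 := by positivity
  have hA := BernoulliCubic.coeff_logSinhcSeries_sq_mul_eq hn1
  have hB := BernoulliCubic.coeff_logSinhcSeries_mul_eq hn1
  have hχ : PowerSeries.coeff (2 * n) BernoulliCubic.cubicSeries =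
      (2 * (n : ℚ) - 1) / 24 * bernoulliBar (2 * n - 2) := by
    rw [BernoulliCubic.cubicSeries, PowerSeries.coeff_mk, if_neg (by omega)]
    push_cast
    rfl
  -- The comparison produces H_{2n-1} and H_{2n-1,2}. Passing to H_{2n} and H_{2n,2} creates the
  -- extra terms that the two -B̄ parts of the statement compensate.
  have hH : harmonic (2 * n) = harmonic m + 1 / (2 * n) := by
    rw [hm, harmonic_succ, ← hmq]
    push_cast
    rw [one_div]
  have hH2 : harmonicTwo (2 * n) = harmonicTwo m + harmonic m / (2 * n) := by
    rw [hm, BernoulliCubic.harmonicTwo_succ, hmq]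
  have hS : ∑ k ∈ Icc 1 (n - 1),
      (Nat.choose (2 * n) (2 * k) : ℚ) * (bernoulli (2 * k) / (2 * (k : ℚ))) *
        (bernoulli (2 * n - 2 * k) - bernoulliBar (2 * n - 2 * k)) =
      ∑ k ∈ Icc 1 (n - 1), (Nat.choose (2 * n) (2 * k) : ℚ) *
        (bernoulli (2 * k) / (2 * (k : ℚ))) * bernoulli (2 * n - 2 * k) -
      ∑ k ∈ Icc 1 (n - 1), (Nat.choose (2 * n) (2 * k) : ℚ) *
        (bernoulli (2 * k) * bernoulliBar (2 * n - 2 * k) / (2 * (k : ℚ))) := by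
    rw [← sum_sub_distrib]
    refine sum_congr rfl fun k _ => ?_
    ring
  rw [← hm, BernoulliCubic.coeff_barLogSeries_pow_three_eq, hχ,
    BernoulliCubic.coeff_two_mul_barSeries] at h
  rw [hS, hH, hH2, hm']
  rw [hf] at hA hB h
  generalize PowerSeries.coeff (2 * n) (BernoulliCubic.logSinhcSeries ^ 2 *
    BernoulliCubic.barSeries) = a at *
  generalize PowerSeries.coeff (2 * n) (BernoulliCubic.logSinhcSeries *
    BernoulliCubic.barSeries) = b at *
  have hb : (m.factorial : ℚ) * (bernoulliBar (2 * n) / (2 * n * m.factorial)) =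
      bernoulliBar (2 * n) / (2 * n) := by
    field_simp
  -- The multipliers turn (2n)! = 2n·m! into the weights 3·m! and 6·H_m·m! occurring in `h`.
  have ha' := congrArg (fun x : ℚ => 3 / (2 * n) * x) hA
  have hb' := congrArg (fun x : ℚ => 3 * harmonic m / n * x) hB
  have e1 : 3 / (2 * (n : ℚ)) * (2 * n * m.factorial * a) = 3 * m.factorial * a := by
    field_simp
  have e2 : 3 * harmonic m / (n : ℚ) * (2 * n * m.factorial * b) =
      6 * harmonic m * m.factorial * b := by
    field_simp
    ring
  rw [e1] at ha'
  rw [e2] at hb'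
  rw [mul_add, mul_add, mul_left_comm _ (6 * harmonicTwo m), hb] at h
  linear_combination h + ha' + hb'
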